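/- Call a field $K$ pseudo-finite if it is infinite and every first-order sentence in the language of rings that holds in $K$ holds in some finite field. Let $\mathrm{PSF}_{\neq 2}$ be the theory of pseudo-finite fields of characteristic $\neq 2$, and let $T_0$ be any completion of $\mathrm{PSF}_{\neq 2}$, i.e. a complete theory in the language of rings which entails $\mathrm{PSF}_{\neq 2}$. Let $L$ be the two-sorted language with a field sort $K$ carrying the language of rings, a vector space sort $V$ carrying the language of abelian groups, scalar multiplication $K \times V \to V$, for every $n \geq 1$ an $n$-ary predicate $\theta_n$ on $V$ and function symbols $\pi_{n,i} : V^{n+1} \to K$ $(1 \leq i \leq n)$, and a function symbol $\beta : V^2 \to K$. Let ${}_{S}T^{T_0}_{\infty}$ (respectively ${}_{A}T^{T_0}_{\infty}$) be the $L$-theory of infinite-dimensional vector spaces $V$ over a field $K \models T_0$ with a non-degenerate symmetric (respectively alternating) bilinear form $\beta$, where $\theta_n(v_1,\dots,v_n)$ holds if and only if $v_1,\dots,v_n$ are linearly independent, and $\pi_{n,i}(v_1,\dots,v_n,w) = \alpha_i$ if $v_1,\dots,v_n$ are linearly independent and $w = \sum_{i} \alpha_i v_i$, and $\pi_{n,i}(v_1,\dots,v_n,w)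 = 0$ otherwise. Then both ${}_{S}T^{T_0}_{\infty}$ and ${}_{A}T^{T_0}_{\infty}$ eliminate quantifiers down to those on the field: modulo the theory, every $L$-formula $\varphi(x)$ is equivalent to an $L$-formula in the same free variables all of whose quantifiers range over the field sort, and indeed to a formula $\psi(t_1(x),\dots,t_k(x))$ where $\psi$ is a formula in the language of rings, interpreted in the field sort, and $t_1,\dots,t_k$ are $L$-terms with values in the field sort. -/

import Mathlib

open FirstOrder

universe u

namespace Granger

/-! ### Field theories -/

/-- A field satisfies a sentence of the language of rings. -/
def FieldSatisfies (K : Type*) [Field K] (σ : Language.ring.Sentence) : Prop :=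
  letI := Ring.compatibleRingOfRing K
  K ⊨ σ

/-- A field is a model of a theory in the language of rings. -/
def FieldModels (K : Type*) [Field K] (T : Language.ring.Theory) : Prop :=
  ∀ σ ∈ T, FieldSatisfies K σ

/-- The truth value in a field of a formula of the language of rings. -/
def FieldRealize (K : Type*) [Field K] {α : Type} (ψ : Language.ring.Formula α) (x : α → K) :
    Prop :=
  letI := Ring.compatibleRingOfRing K
  ψ.Realize x

/-- A field is pseudo-finite if it is infinite and every sentence of the language of rings that
holds in it also holds in some finite field. -/
def IsPseudofiniteField (K : Type*) [Field K] : Prop :=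
  Infinite K ∧ ∀ σ : Language.ring.Sentence, FieldSatisfies K σ →
    ∃ (F : Type) (_ : Field F), Finite F ∧ FieldSatisfies F σ

/-- The theory of pseudo-finite fields of characteristic different from `2`. -/
def PSFNeTwo : Language.ring.Theory :=
  {σ | ∀ (K : Type) [Field K], IsPseudofiniteField K → ringChar K ≠ 2 → FieldSatisfies K σ}

/-- `T₀` is a completion of `T`: a complete (in particular satisfiable) theory with `T` among its
consequences. -/
def IsCompletionOf (T₀ T : Language.ring.Theory) : Prop :=
  T₀.IsComplete ∧ ∀ σ ∈ T, T₀ ⊨ᵇ σ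

/-! ### The two-sorted language -/

mutual

/-- Terms of the field sort, in `m` variables of the field sort and `n` variables of the vector
space sort. -/
inductive FTerm (m n : ℕ) : Type
  | var : Fin m → FTerm m n
  | zero : FTerm m n
  | one : FTerm m n
  | neg : FTerm m n → FTerm m n
  | add : FTerm m n → FTerm m n → FTerm m n
  | mul : FTerm m n → FTerm m n → FTerm m n
  /-- the coordinate function `π_{k,i}(v₁, …, v_k, w)`; `k ≥ 1` because of `i : Fin k` -/
  | coord : (k : ℕ) → (i : Fin k) → (Fin k → VTerm m n) → VTerm m n → FTerm m n
  /-- the bilinear form `β(v, w)` -/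
  | form : VTerm m n → VTerm m n → FTerm m n

/-- Terms of the vector space sort, in `m` variables of the field sort and `n` variables of the
vector space sort. -/
inductive VTerm (m n : ℕ) : Type
  | var : Fin n → VTerm m n
  | zero : VTerm m n
  | neg : VTerm m n → VTerm m n
  | add : VTerm m n → VTerm m n → VTerm m n
  | smul : FTerm m n → VTerm m n → VTerm m n

end

/-- Formulas with free variables among `m` variables of the field sort and `n` variables of the
vector space sort. A quantifier over a sort binds the last variable of that sort. The remaining
connectives and the existential quantifiers are the usual abbreviations. -/
inductive Formula : ℕ → ℕ → Type
  | falsum {m n : ℕ} : Formula m n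
  | eqF {m n : ℕ} : FTerm m n → FTerm m n → Formula m n
  | eqV {m n : ℕ} : VTerm m n → VTerm m n → Formula m n
  /-- the linear independence predicate `θ_{k+1}` -/
  | indep {m n : ℕ} : (k : ℕ) → (Fin (k + 1) → VTerm m n) → Formula m n
  | imp {m n : ℕ} : Formula m n → Formula m n → Formula m n
  | allF {m n : ℕ} : Formula (m + 1) n → Formula m n
  | allV {m n : ℕ} : Formula m (n + 1) → Formula m n

/-- All quantifiers of the formula range over the field sort. -/
def Formula.OnlyFieldQuantifiers : {m n : ℕ} → Formula m n → Prop
  | _, _, .falsum => True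
  | _, _, .eqF _ _ => True
  | _, _, .eqV _ _ => True
  | _, _, .indep _ _ => True
  | _, _, .imp φ ψ => φ.OnlyFieldQuantifiers ∧ ψ.OnlyFieldQuantifiers
  | _, _, .allF φ => φ.OnlyFieldQuantifiers
  | _, _, .allV _ => False

/-! ### Interpretation in a vector space with a bilinear form -/

section Semantics

variable {K V : Type u} [Field K] [AddCommGroup V] [Module K V]

open Classical in
/-- The `i`-th coordinate of `w` with respect to `v` if `v` is linearly independent and `w` lies in
its span, and zero otherwise. -/
noncomputable def coordinate {k : ℕ} (v : Fin k → V) (w : V) (i : Fin k) : K :=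
  if h : LinearIndependent K v ∧ w ∈ Submodule.span K (Set.range v) then
    h.1.repr ⟨w, h.2⟩ i
  else 0

mutual

/-- The value of a term of the field sort. -/
noncomputable def FTerm.realize (β : LinearMap.BilinForm K V) {m n : ℕ} (x : Fin m → K)
    (y : Fin n → V) : FTerm m n → K
  | .var i => x i
  | .zero => 0
  | .one => 1
  | .neg s => -(s.realize β x y)
  | .add s t => s.realize β x y + t.realize β x y
  | .mul s t => s.realize β x y * t.realize β x y
  | .coord _ i v w => coordinate (fun j => (v j).realize β x y) (w.realize β x y) i
  | .form v w => β (v.realize β x y) (w.realize β x y)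

/-- The value of a term of the vector space sort. -/
noncomputable def VTerm.realize (β : LinearMap.BilinForm K V) {m n : ℕ} (x : Fin m → K)
    (y : Fin n → V) : VTerm m n → V
  | .var i => y i
  | .zero => 0
  | .neg v => -(v.realize β x y)
  | .add v w => v.realize β x y + w.realize β x y
  | .smul s v => s.realize β x y • v.realize β x y

end

/-- Satisfaction of a formula. -/
def Formula.Realize (β : LinearMap.BilinForm K V) :
    {m n : ℕ} → Formula m n → (Fin m → K) → (Fin n → V) → Prop
  | _, _, .falsum, _, _ => False
  | _, _, .eqF s t, x, y => s.realize β x y = t.realize β x y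
  | _, _, .eqV v w, x, y => v.realize β x y = w.realize β x y
  | _, _, .indep _ v, x, y => LinearIndependent K (fun j => (v j).realize β x y)
  | _, _, .imp φ ψ, x, y => φ.Realize β x y → ψ.Realize β x y
  | _, _, .allF φ, x, y => ∀ a : K, φ.Realize β (Fin.snoc x a) y
  | _, _, .allV φ, x, y => ∀ v : V, φ.Realize β x (Fin.snoc y v)

end Semantics

/-! ### The two theories and elimination of quantifiers down to the field -/

/-- The two kinds of bilinear forms. -/
inductive FormKind
  | symmetric
  | alternating

/-- The bilinear form is of the given kind. -/
def FormKind.Holds {K V : Type u} [Field K] [AddCommGroup V] [Module K V]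
    (β : LinearMap.BilinForm K V) : FormKind → Prop
  | .symmetric => β.IsSymm
  | .alternating => β.IsAlt

/-- The models of the two-sorted theory of infinite-dimensional vector spaces over a field
`K ⊨ T₀` with a non-degenerate symmetric (respectively alternating) bilinear form. -/
structure IsModel (κ : FormKind) (T₀ : Language.ring.Theory) (K V : Type u) [Field K]
    [AddCommGroup V] [Module K V] (β : LinearMap.BilinForm K V) : Prop where
  field_models : FieldModels K T₀
  infinite_dimensional : ¬ FiniteDimensional K V
  nondegenerate : β.Nondegenerate
  kind : κ.Holds β

/-- Two formulas in the same free variables are equivalent in all models of the theory. -/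
def EquivMod (κ : FormKind) (T₀ : Language.ring.Theory) {m n : ℕ} (φ ψ : Formula m n) : Prop :=
  ∀ (K V : Type u) [Field K] [AddCommGroup V] [Module K V]
    (β : LinearMap.BilinForm K V), IsModel κ T₀ K V β →
      ∀ (x : Fin m → K) (y : Fin n → V), φ.Realize β x y ↔ ψ.Realize β x y

/-- In all models of the theory, `φ` is equivalent to `ψ(t₁, …, t_k)`, where `ψ` is a formula of
the language of rings, evaluated in the field, and the `tᵢ` are terms of the field sort. -/
def EquivModFieldFormula (κ : FormKind) (T₀ : Language.ring.Theory) {m n : ℕ} (φ : Formula m n)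
    {k : ℕ} (ψ : Language.ring.Formula (Fin k)) (t : Fin k → FTerm m n) : Prop :=
  ∀ (K V : Type u) [Field K] [AddCommGroup V] [Module K V]
    (β : LinearMap.BilinForm K V), IsModel κ T₀ K V β →
      ∀ (x : Fin m → K) (y : Fin n → V),
        φ.Realize β x y ↔ FieldRealize K ψ (fun i => (t i).realize β x y)

/-- The theory eliminates quantifiers down to those on the field: every formula is equivalent,
modulo the theory, to a formula all of whose quantifiers range over the field sort, and indeed to
a field formula evaluated at terms of the field sort (so that only the full first-order structure
of the field remains). -/
def EliminatesQuantifiersDownToField (κ : FormKind) (T₀ : Language.ring.Theory) : Prop :=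
  ∀ (m n : ℕ) (φ : Formula m n),
    (∃ ψ : Formula m n, ψ.OnlyFieldQuantifiers ∧ EquivMod.{u} κ T₀ φ ψ) ∧
    (∃ (k : ℕ) (ψ : Language.ring.Formula (Fin k)) (t : Fin k → FTerm m n),
      EquivModFieldFormula.{u} κ T₀ φ ψ t)

end Granger

/-!
A formula `φ(x, y)` sees the vectors `y` only through field data: the linear relations between
them and their Gram matrix. To record the relations by field elements, a matrix `M` is said to
present `y` if its kernel is the space of relations (`Presents`). The central claim
(`Formula.exists_definedBy`) is that every formula is equivalent to a formula of the language of
rings in `x`, the entries of the Gram matrix, and the entries of any matrix presenting `y`. It is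
proved by induction on formulas. Definability is handled semantically, uniformly in the field
(`UDef`), so that no formula has to be written out.

For atomic formulas, the value of a vector term is represented by its coefficient tuples with
respect to `y`, which are definable up to relations (`VTerm.exists_definedBy`); linear independence
and coordinates then are statements about tuples of field elements. Quantifiers over the field
are kept.

The crucial case is a quantifier over a vector `v`. If `v` lies in the span of `y`, it is
replaced by its coefficients, and the new data are polynomials in the old data and the
coefficients (`spanExt`). If `v` is outside the span, the new data consist of the old data, the
values `β(yᵢ, v)` and `β(v, v)` (`freeExt`), and all values which respect the relations between the
`yᵢ` occur, except that `β(v, v) = 0` for an alternating form (`IsModel.exists_notMem_span`). The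
values `β(yᵢ, v)` are realized by non-degeneracy, and then `v` can be changed by vectors orthogonal
to everything so far, as the dimension is infinite. In the symmetric case, three orthogonal
anisotropic vectors suffice to correct `β(v, v)`, because `a x² + b y²` represents every element of
the field if `a, b ≠ 0`. In characteristic other than `2` that holds in every finite field, hence in
every pseudo-finite field and in every model of `T₀`; this is the only property of the fields that
is used.

Finally, a presenting matrix is obtained from terms (`relationTerm`): its entries are the
coordinates of the `yⱼ` with respect to the subfamilies of `y`, multiplied by a term which
vanishes unless the subfamily is a basis of the span.
-/

namespace Granger

/-! ### Uniformly definable relations on fields -/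

/-- A relation on tuples of field elements, given uniformly for all fields, is definable by a
single formula of the language of rings. -/
def UDef {α : Type} (P : ∀ (K : Type u) [Field K], (α → K) → Prop) : Prop :=
  ∃ ψ : Language.ring.Formula α, ∀ (K : Type u) [Field K] (x : α → K),
    FieldRealize K ψ x ↔ P K x

/-- A function of tuples of field elements, given uniformly for all fields, is the value of a
single term of the language of rings. -/
def UPoly {α : Type} (p : ∀ (K : Type u) [Field K], (α → K) → K) : Prop :=
  ∃ t : Language.ring.Term α, ∀ (K : Type u) [Field K] (x : α → K),
    letI := Ring.compatibleRingOfRing K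
    t.realize x = p K x

namespace UPoly

variable {α : Type}

theorem var (a : α) : UPoly.{u} fun _ _ x => x a :=
  ⟨.var a, fun _ _ _ => rfl⟩

theorem zero : UPoly.{u} (α := α) fun _ _ _ => 0 :=
  ⟨0, fun K _ x => by
    let := Ring.compatibleRingOfRing K
    simp⟩

theorem one : UPoly.{u} (α := α) fun _ _ _ => 1 :=
  ⟨1, fun K _ x => by
    let := Ring.compatibleRingOfRing K
    simp⟩

theorem neg {p : ∀ (K : Type u) [Field K], (α → K) → K} (hp : UPoly p) :
    UPoly fun K _ x => -p K x := by
  obtain ⟨t, ht⟩ := hp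
  refine ⟨-t, fun K _ x => ?_⟩
  let := Ring.compatibleRingOfRing K
  beta_reduce
  rw [← ht K x]
  simp

theorem add {p q : ∀ (K : Type u) [Field K], (α → K) → K} (hp : UPoly p) (hq : UPoly q) :
    UPoly fun K _ x => p K x + q K x := by
  obtain ⟨t, ht⟩ := hp
  obtain ⟨s, hs⟩ := hq
  refine ⟨t + s, fun K _ x => ?_⟩
  let := Ring.compatibleRingOfRing K
  beta_reduce
  rw [← ht K x, ← hs K x]
  simp

theorem mul {p q : ∀ (K : Type u) [Field K], (α → K) → K} (hp : UPoly p) (hq : UPoly q) :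
    UPoly fun K _ x => p K x * q K x := by
  obtain ⟨t, ht⟩ := hp
  obtain ⟨s, hs⟩ := hq
  refine ⟨t * s, fun K _ x => ?_⟩
  let := Ring.compatibleRingOfRing K
  beta_reduce
  rw [← ht K x, ← hs K x]
  simp

theorem sum {n : ℕ} {p : Fin n → ∀ (K : Type u) [Field K], (α → K) → K}
    (hp : ∀ i, UPoly (p i)) : UPoly fun K _ x => ∑ i, p i K x := by
  induction n with
  | zero => simpa using zero
  | succ n ih =>
    simp only [Fin.sum_univ_castSucc]
    exact (ih fun i => hp _).add (hp _)

end UPoly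

namespace UDef

variable {α : Type}

theorem eq {p q : ∀ (K : Type u) [Field K], (α → K) → K} (hp : UPoly p) (hq : UPoly q) :
    UDef fun K _ x => p K x = q K x := by
  obtain ⟨t, ht⟩ := hp
  obtain ⟨s, hs⟩ := hq
  refine ⟨t.equal s, fun K _ x => ?_⟩
  let := Ring.compatibleRingOfRing K
  beta_reduce
  rw [← ht K x, ← hs K x]
  exact Language.Formula.realize_equal

theorem false : UDef.{u} (α := α) fun _ _ _ => False :=
  ⟨⊥, fun _ _ _ => Iff.rfl⟩

theorem imp {P Q : ∀ (K : Type u) [Field K], (α → K) → Prop} (hP : UDef P) (hQ : UDef Q) :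
    UDef fun K _ x => P K x → Q K x := by
  obtain ⟨t, ht⟩ := hP
  obtain ⟨s, hs⟩ := hQ
  refine ⟨t.imp s, fun K _ x => ?_⟩
  beta_reduce
  rw [← ht K x, ← hs K x]
  exact Iff.rfl

theorem not {P : ∀ (K : Type u) [Field K], (α → K) → Prop} (hP : UDef P) :
    UDef fun K _ x => ¬ P K x :=
  hP.imp false

theorem and {P Q : ∀ (K : Type u) [Field K], (α → K) → Prop} (hP : UDef P) (hQ : UDef Q) :
    UDef fun K _ x => P K x ∧ Q K x := by
  simpa using (hP.imp hQ.not).not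

theorem or {P Q : ∀ (K : Type u) [Field K], (α → K) → Prop} (hP : UDef P) (hQ : UDef Q) :
    UDef fun K _ x => P K x ∨ Q K x := by
  simpa [or_iff_not_imp_left] using hP.not.imp hQ

theorem forall_index {ι : Type} [Finite ι] {P : ι → ∀ (K : Type u) [Field K], (α → K) → Prop}
    (hP : ∀ i, UDef (P i)) : UDef fun K _ x => ∀ i, P i K x := by
  choose ψ hψ using hP
  refine ⟨Language.Formula.iInf ψ, fun K _ x => ?_⟩
  simp only [← hψ]
  let := Ring.compatibleRingOfRing K
  exact Language.Formula.realize_iInf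

theorem exists_tuple {ι : Type} [Finite ι]
    {P : ∀ (K : Type u) [Field K], (α → K) → (ι → K) → Prop}
    (hP : UDef (α := α ⊕ ι) fun K _ z => P K (fun a => z (.inl a)) (fun i => z (.inr i))) :
    UDef fun K _ x => ∃ c, P K x c := by
  obtain ⟨ψ, hψ⟩ := hP
  refine ⟨ψ.iExs ι, fun K _ x => ?_⟩
  let := Ring.compatibleRingOfRing K
  refine Language.Formula.realize_iExs.trans (exists_congr fun c => ?_)
  exact hψ K (Sum.elim x c)

theorem forall_tuple {ι : Type} [Finite ι]
    {P : ∀ (K : Type u) [Field K], (α → K) → (ι → K) → Prop}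
    (hP : UDef (α := α ⊕ ι) fun K _ z => P K (fun a => z (.inl a)) (fun i => z (.inr i))) :
    UDef fun K _ x => ∀ c, P K x c := by
  simpa using (exists_tuple (P := fun K _ x c => ¬ P K x c) hP.not).not

theorem subst {γ : Type} {P : ∀ (K : Type u) [Field K], (α → K) → Prop} (hP : UDef P)
    {p : α → ∀ (K : Type u) [Field K], (γ → K) → K} (hp : ∀ a, UPoly (p a)) :
    UDef fun K _ x => P K fun a => p a K x := by
  obtain ⟨ψ, hψ⟩ := hP
  choose t ht using hp
  refine ⟨Language.BoundedFormula.subst ψ t, fun K _ x => ?_⟩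
  beta_reduce
  rw [← hψ K]
  let := Ring.compatibleRingOfRing K
  simp only [← ht]
  exact Language.BoundedFormula.realize_subst

theorem comp {γ : Type} {P : ∀ (K : Type u) [Field K], (α → K) → Prop} (hP : UDef P)
    {f : ∀ (K : Type u) [Field K], (γ → K) → α → K}
    (hf : ∀ a, UPoly fun K _ z => f K z a) : UDef fun K _ z => P K (f K z) :=
  hP.subst hf

end UDef

/-! ### Vectors with prescribed values of the form -/

section LinearAlgebra

variable {K V : Type u} [Field K] [AddCommGroup V] [Module K V] {β : LinearMap.BilinForm K V}

/-- A non-degenerate form on a space of any dimension realizes every system of prescribed values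
on finitely many vectors which is compatible with the linear relations between them: a functional
vanishing on all attained systems of values is itself such a relation. -/
theorem exists_form_eq (hβ : β.Nondegenerate) {ι : Type*} [Fintype ι] (y : ι → V) (b : ι → K)
    (hb : ∀ c : ι → K, ∑ i, c i • y i = 0 → ∑ i, c i * b i = 0) :
    ∃ v, ∀ i, β (y i) v = b i := by
  classical
  let L : V →ₗ[K] ι → K := LinearMap.pi fun i => β (y i)
  suffices h : b ∈ LinearMap.range L by
    obtain ⟨v, hv⟩ := h
    exact ⟨v, fun i => congrFun hv i⟩
  by_contra h
  obtain ⟨f, hf, hL⟩ := Submodule.exists_le_ker_of_notMem h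
  rw [LinearMap.pi_apply_eq_sum_univ f b] at hf
  refine hf ?_
  simp only [smul_eq_mul, mul_comm (b _)]
  refine hb _ (hβ.1 _ fun v => ?_)
  have hv : f (L v) = 0 := hL ⟨v, rfl⟩
  rw [LinearMap.pi_apply_eq_sum_univ f] at hv
  simpa [L, mul_comm] using hv

theorem exists_orthogonal_form_ne_zero (hβ : β.Nondegenerate) (W : Submodule K V)
    [FiniteDimensional K W] {z : V} (hz : z ∉ W) :
    ∃ v, (∀ w ∈ W, β w v = 0) ∧ β z v ≠ 0 := by
  obtain ⟨k, y, hy⟩ := Submodule.fg_iff_exists_fin_generating_family.1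
    ((Module.Finite.iff_fg (N := W)).1 inferInstance)
  obtain ⟨v, hv⟩ := exists_form_eq hβ (fun o : Option (Fin k) => o.elim z y)
    (fun o => o.elim 1 fun _ => 0) (fun c hc => by
      simp only [Fintype.sum_option, Option.elim] at hc ⊢
      by_contra h
      refine hz ?_
      have h0 : c none ≠ 0 := by simpa using h
      rw [← Submodule.smul_mem_iff W h0, eq_neg_of_add_eq_zero_left hc]
      refine W.neg_mem (W.sum_mem fun i _ => W.smul_mem _ ?_)
      rw [← hy]
      exact Submodule.subset_span ⟨i, rfl⟩)
  refine ⟨v, fun w hw => ?_, ?_⟩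
  · rw [← hy] at hw
    have : Submodule.span K (Set.range y) ≤ LinearMap.ker (β.flip v) := by
      rw [Submodule.span_le]
      rintro _ ⟨i, rfl⟩
      simpa using hv (some i)
    simpa using this hw
  · have := hv none
    simp only [Option.elim] at this
    rw [this]
    exact one_ne_zero

theorem exists_orthogonal_notMem (hV : ¬ FiniteDimensional K V) (W : Submodule K V)
    [FiniteDimensional K W] : ∃ v ∉ W, ∀ w ∈ W, β w v = 0 := by
  by_contra! h
  refine hV (Module.finite_def.2 (Submodule.fg_of_fg_map_of_fg_inf_ker
    ((LinearMap.lcomp K K W.subtype).comp β.flip) ?_ ?_))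
  · exact IsNoetherian.noetherian _
  · rw [top_inf_eq]
    refine Module.Finite.iff_fg.1 (Submodule.finiteDimensional_of_le (S₂ := W) fun v hv => ?_)
    by_contra hvW
    obtain ⟨w, hw, hne⟩ := h v hvW
    exact hne (LinearMap.congr_fun (LinearMap.mem_ker.1 hv) ⟨w, hw⟩)

/-- In characteristic other than `2` a symmetric form that vanishes on the diagonal of a subspace
vanishes on that subspace, which is impossible for the orthogonal complement of a
finite-dimensional one. -/
theorem exists_orthogonal_anisotropic (hV : ¬ FiniteDimensional K V) (hβ : β.Nondegenerate)
    (hs : β.IsSymm) (h2 : (2 : K) ≠ 0) (W : Submodule K V) [FiniteDimensional K W] :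
    ∃ v, (∀ w ∈ W, β w v = 0) ∧ β v v ≠ 0 := by
  obtain ⟨w, hwW, hw⟩ := exists_orthogonal_notMem (β := β) hV W
  obtain ⟨v, hv, hwv⟩ := exists_orthogonal_form_ne_zero hβ W hwW
  by_contra! h
  have h1 := h w hw
  have h3 := h v hv
  have h4 := h (w + v) fun u hu => by rw [map_add, hw u hu, hv u hu, add_zero]
  simp only [map_add, LinearMap.add_apply, h1, h3, hs.eq v w] at h4
  refine mul_ne_zero h2 hwv ?_
  linear_combination h4

theorem exists_notMem_span_of_isSymm (hV : ¬ FiniteDimensional K V) (hβ : β.Nondegenerate)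
    (hs : β.IsSymm) (h2 : (2 : K) ≠ 0)
    (hK : ∀ a b c : K, a ≠ 0 → b ≠ 0 → ∃ x y, a * (x * x) + b * (y * y) = c)
    {n : ℕ} (y : Fin n → V) (b : Fin n → K)
    (hb : ∀ c : Fin n → K, ∑ i, c i • y i = 0 → ∑ i, c i * b i = 0) (e : K) :
    ∃ v, v ∉ Submodule.span K (Set.range y) ∧ (∀ i, β (y i) v = b i) ∧ β v v = e := by
  obtain ⟨v₀, hv₀⟩ := exists_form_eq hβ y b hb
  have : FiniteDimensional K (Submodule.span K (Set.range y)) :=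
    FiniteDimensional.span_of_finite K (Set.finite_range y)
  let W₁ := Submodule.span K (Set.range y) ⊔ Submodule.span K {v₀}
  obtain ⟨w₁, hw₁, ha₁⟩ := exists_orthogonal_anisotropic hV hβ hs h2 W₁
  let W₂ := W₁ ⊔ Submodule.span K {w₁}
  obtain ⟨w₂, hw₂, ha₂⟩ := exists_orthogonal_anisotropic hV hβ hs h2 W₂
  let W₃ := W₂ ⊔ Submodule.span K {w₂}
  obtain ⟨w₃, hw₃, ha₃⟩ := exists_orthogonal_anisotropic hV hβ hs h2 W₃
  have h12 : W₁ ≤ W₂ := le_sup_left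
  have h23 : W₂ ≤ W₃ := le_sup_left
  have hy : Submodule.span K (Set.range y) ≤ W₁ := le_sup_left
  have hyi (i) : y i ∈ Submodule.span K (Set.range y) := Submodule.subset_span ⟨i, rfl⟩
  have mv₀ : v₀ ∈ W₁ := le_sup_right (a := Submodule.span K (Set.range y))
    (Submodule.mem_span_singleton_self v₀)
  have mw₁ : w₁ ∈ W₂ := le_sup_right (a := W₁) (Submodule.mem_span_singleton_self w₁)
  have mw₂ : w₂ ∈ W₃ := le_sup_right (a := W₂) (Submodule.mem_span_singleton_self w₂)
  have e01 := hw₁ v₀ mv₀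
  have e02 := hw₂ v₀ (h12 mv₀)
  have e03 := hw₃ v₀ (h23 (h12 mv₀))
  have e12 := hw₂ w₁ mw₁
  have e13 := hw₃ w₁ (h23 mw₁)
  have e23 := hw₃ w₂ mw₂
  obtain ⟨p, q, hpq⟩ := hK _ _ (e - β v₀ v₀ - β w₃ w₃) ha₁ ha₂
  -- the summand `w₃` keeps the vector outside the span even if `w₁` and `w₂` do not occur
  refine ⟨v₀ + (p • w₁ + q • w₂ + w₃), fun hmem => ha₃ ?_, fun i => ?_, ?_⟩
  · have := hw₃ _ (h23 (h12 (hy hmem)))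
    simpa [e03, e13, e23] using this
  · simp [hv₀, hw₁ _ (hy (hyi i)), hw₂ _ (h12 (hy (hyi i))), hw₃ _ (h23 (h12 (hy (hyi i))))]
  · simp only [map_add, LinearMap.add_apply, map_smul, LinearMap.smul_apply, smul_eq_mul, e01, e02,
      e03, e12, e13, e23, hs.eq w₁ v₀, hs.eq w₂ v₀, hs.eq w₃ v₀, hs.eq w₂ w₁, hs.eq w₃ w₁,
      hs.eq w₃ w₂]
    linear_combination hpq

theorem exists_notMem_span_of_nondegenerate (hV : ¬ FiniteDimensional K V) (hβ : β.Nondegenerate)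
    {n : ℕ} (y : Fin n → V) (b : Fin n → K)
    (hb : ∀ c : Fin n → K, ∑ i, c i • y i = 0 → ∑ i, c i * b i = 0) :
    ∃ v, v ∉ Submodule.span K (Set.range y) ∧ ∀ i, β (y i) v = b i := by
  obtain ⟨v₀, hv₀⟩ := exists_form_eq hβ y b hb
  have : FiniteDimensional K (Submodule.span K (Set.range y)) :=
    FiniteDimensional.span_of_finite K (Set.finite_range y)
  obtain ⟨w, hwW, hw⟩ := exists_orthogonal_notMem (β := β) hV
    (Submodule.span K (Set.range y) ⊔ Submodule.span K {v₀})
  have hy : Submodule.span K (Set.range y) ≤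
    Submodule.span K (Set.range y) ⊔ Submodule.span K {v₀} := le_sup_left
  refine ⟨v₀ + w, fun hmem => hwW ?_, fun i => ?_⟩
  · rw [← add_sub_cancel_left v₀ w]
    exact Submodule.sub_mem _ (hy hmem) (le_sup_right (a := Submodule.span K (Set.range y))
      (Submodule.mem_span_singleton_self v₀))
  · rw [map_add, hv₀, hw _ (hy (Submodule.subset_span ⟨i, rfl⟩)), add_zero]

end LinearAlgebra

/-! ### The fields in question -/

/-- The sentence expressing that, unless the characteristic is `2`, every binary quadratic form
`a x² + b y²` with `a, b ≠ 0` represents every element. -/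
def binaryFormsUniversal : Language.ring.Sentence :=
  ∀' ∀' ∀' ((Language.Term.bdEqual (&0) 0).not ⟹ (Language.Term.bdEqual (&1) 0).not ⟹
    (Language.Term.bdEqual (1 + 1) 0).not ⟹
      ∃' ∃' (Language.Term.bdEqual (&0 * (&3 * &3) + &1 * (&4 * &4)) &2))

theorem fieldSatisfies_binaryFormsUniversal (K : Type*) [Field K] :
    FieldSatisfies K binaryFormsUniversal ↔ ∀ a b c : K, a ≠ 0 → b ≠ 0 → (1 + 1 : K) ≠ 0 →
      ∃ x y, a * (x * x) + b * (y * y) = c := by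
  let := Ring.compatibleRingOfRing K
  simp [FieldSatisfies, binaryFormsUniversal, Language.Sentence.Realize, Language.Formula.Realize,
    Fin.snoc]

/-- Counting values: in a finite field of odd order `a x²` and `c - b y²` each take more than half
of all values. -/
theorem exists_binary_form_eq_of_finite (F : Type*) [Field F] [Finite F] {a b c : F} (ha : a ≠ 0)
    (hb : b ≠ 0) (h2 : (1 + 1 : F) ≠ 0) : ∃ x y, a * (x * x) + b * (y * y) = c := by
  have := Fintype.ofFinite F
  have hchar : ringChar F ≠ 2 := fun h => h2 (by
    have : ((ringChar F : ℕ) : F) = 0 := CharP.cast_eq_zero F (ringChar F)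
    rw [h] at this
    norm_num at this
    rw [one_add_one_eq_two, this])
  obtain ⟨x, y, hxy⟩ := FiniteField.exists_root_sum_quadratic
    (Polynomial.degree_quadratic (b := 0) (c := 0) ha)
    (Polynomial.degree_quadratic (b := 0) (c := -c) hb) (FiniteField.odd_card_of_char_ne_two hchar)
  refine ⟨x, y, ?_⟩
  simp at hxy
  linear_combination hxy

theorem binaryFormsUniversal_mem : binaryFormsUniversal ∈ PSFNeTwo := by
  intro K _ hK _
  by_contra h
  obtain ⟨F, _, _, hF⟩ := hK.2 binaryFormsUniversal.not h
  exact hF ((fieldSatisfies_binaryFormsUniversal F).2 fun a b c ha hb h2 =>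
    exists_binary_form_eq_of_finite F ha hb h2)

/-- The sentence expressing that the characteristic is not `2`. -/
def charNeTwo : Language.ring.Sentence :=
  (Language.Term.bdEqual (1 + 1) 0).not

theorem fieldSatisfies_charNeTwo (K : Type*) [Field K] :
    FieldSatisfies K charNeTwo ↔ (1 + 1 : K) ≠ 0 := by
  let := Ring.compatibleRingOfRing K
  simp [FieldSatisfies, charNeTwo, Language.Sentence.Realize, Language.Formula.Realize]

theorem charNeTwo_mem : charNeTwo ∈ PSFNeTwo := by
  intro K _ _ h2
  rw [fieldSatisfies_charNeTwo, one_add_one_eq_two]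
  exact Ring.two_ne_zero h2

theorem IsCompletionOf.fieldSatisfies {T₀ T : Language.ring.Theory} (h : IsCompletionOf T₀ T)
    {K : Type*} [Field K] (hK : FieldModels K T₀) {σ : Language.ring.Sentence} (hσ : σ ∈ T) :
    FieldSatisfies K σ := by
  let := Ring.compatibleRingOfRing K
  have : K ⊨ T₀ := ⟨fun σ hσ => hK σ hσ⟩
  exact (h.2 σ hσ).realize_sentence K

/-! ### Field data of a tuple of vectors -/

/-- The rows of the matrix `M` are linear equations for the space of linear relations between the
vectors `y`. -/
def Presents {K V : Type u} [Field K] [AddCommGroup V] [Module K V] {r n : ℕ}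
    (M : Fin r → Fin n → K) (y : Fin n → V) : Prop :=
  ∀ c : Fin n → K, (∀ i, ∑ j, M i j * c j = 0) ↔ ∑ j, c j • y j = 0

/-- Indices for the entries of a tuple of length `m`, of an `r × n` matrix and of an `n × n`
matrix. -/
abbrev DataIndex (m r n : ℕ) : Type :=
  Fin m ⊕ (Fin r × Fin n) ⊕ (Fin n × Fin n)

/-- The entries of a tuple and of two matrices, as a single tuple. -/
def dataTuple {K : Type u} {m r n : ℕ} (x : Fin m → K) (M : Fin r → Fin n → K)
    (G : Fin n → Fin n → K) : DataIndex m r n → K :=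
  Sum.elim x (Sum.elim (fun p => M p.1 p.2) fun p => G p.1 p.2)

/-- The entries of the tuple `x`, of a matrix `M` and of the Gram matrix of `y`. -/
def formData {K V : Type u} [Field K] [AddCommGroup V] [Module K V]
    (β : LinearMap.BilinForm K V) {m r n : ℕ} (x : Fin m → K) (M : Fin r → Fin n → K)
    (y : Fin n → V) : DataIndex m r n → K :=
  dataTuple x M fun i j => β (y i) (y j)

/-- The coefficient tuples `c` and `d` represent the same vector: their difference solves the
linear equations given by the matrix contained in the data `e`. -/
def SameVector {K : Type u} [Field K] {m r n : ℕ} (e : DataIndex m r n → K) (c d : Fin n → K) :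
    Prop :=
  ∀ i : Fin r, ∑ j, e (.inr (.inl (i, j))) * (c j + -d j) = 0

theorem Presents.sameVector_iff {K V : Type u} [Field K] [AddCommGroup V] [Module K V]
    {β : LinearMap.BilinForm K V} {m r n : ℕ} {x : Fin m → K} {M : Fin r → Fin n → K}
    {y : Fin n → V} (h : Presents M y) (c d : Fin n → K) :
    SameVector (formData β x M y) c d ↔ ∑ j, c j • y j = ∑ j, d j • y j := by
  rw [← sub_eq_zero, ← Finset.sum_sub_distrib]
  simp only [← sub_smul]
  rw [← h fun j => c j - d j]
  simp [SameVector, formData, dataTuple, sub_eq_add_neg]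

/-- A uniformly definable relation between two tuples of field elements. -/
def UDefRel {α ι : Type} (P : ∀ (K : Type u) [Field K], (α → K) → (ι → K) → Prop) : Prop :=
  UDef (α := α ⊕ ι) fun K _ z => P K (fun a => z (.inl a)) (fun i => z (.inr i))

theorem UDefRel.subst {α ι γ : Type}
    {P : ∀ (K : Type u) [Field K], (α → K) → (ι → K) → Prop} (hP : UDefRel P)
    {p : α → ∀ (K : Type u) [Field K], (γ → K) → K}
    {q : ι → ∀ (K : Type u) [Field K], (γ → K) → K}
    (hp : ∀ a, UPoly (p a)) (hq : ∀ i, UPoly (q i)) :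
    UDef fun K _ x => P K (fun a => p a K x) (fun i => q i K x) :=
  UDef.subst hP (p := Sum.elim p q) (by rintro (a | i); exacts [hp a, hq i])

theorem UDef.sameVector {γ : Type} {m r n : ℕ}
    {p : DataIndex m r n → ∀ (K : Type u) [Field K], (γ → K) → K}
    {c d : Fin n → ∀ (K : Type u) [Field K], (γ → K) → K}
    (hp : ∀ a, UPoly (p a)) (hc : ∀ i, UPoly (c i)) (hd : ∀ i, UPoly (d i)) :
    UDef fun K _ x => SameVector (fun a => p a K x) (fun i => c i K x) (fun i => d i K x) :=
  forall_index fun _ => eq (UPoly.sum fun j => (hp _).mul ((hc j).add (hd j).neg)) UPoly.zero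

/-! ### Values of terms are definable from the field data -/

section Coordinates

variable {K V : Type u} [Field K] [AddCommGroup V] [Module K V]

theorem coordinate_eq {k : ℕ} {v : Fin k → V} (hv : LinearIndependent K v) (a : Fin k → K)
    (i : Fin k) : coordinate v (∑ j, a j • v j) i = a i := by
  have hw : ∑ j, a j • v j ∈ Submodule.span K (Set.range v) :=
    (Submodule.mem_span_range_iff_exists_fun K).2 ⟨a, rfl⟩
  rw [coordinate, dif_pos ⟨hv, hw⟩, hv.repr_eq (l := Finsupp.equivFunOnFinite.symm a)]
  · rfl
  · exact Finsupp.linearCombination_eq_fintype_linearCombination_apply K v a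

theorem eq_coordinate_iff {k : ℕ} (v : Fin k → V) (w : V) (i : Fin k) (z : K) :
    z = coordinate v w i ↔
      (∃ a : Fin k → K, (LinearIndependent K v ∧ w = ∑ j, a j • v j) ∧ z = a i) ∨
      (∀ a : Fin k → K, ¬ (LinearIndependent K v ∧ w = ∑ j, a j • v j)) ∧ z = 0 := by
  by_cases h : ∃ a : Fin k → K, LinearIndependent K v ∧ w = ∑ j, a j • v j
  · obtain ⟨a, hv, rfl⟩ := h
    rw [coordinate_eq hv]
    constructor
    · intro h
      exact .inl ⟨a, ⟨hv, rfl⟩, h⟩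
    · rintro (⟨b, ⟨_, hb⟩, h⟩ | ⟨h, _⟩)
      · rw [h, ← coordinate_eq hv b, ← hb, coordinate_eq hv]
      · exact (h a ⟨hv, rfl⟩).elim
  · have h' : ∀ a : Fin k → K, ¬ (LinearIndependent K v ∧ w = ∑ j, a j • v j) :=
      not_exists.1 h
    have h0 : coordinate (K := K) v w i = 0 := by
      refine dif_neg fun hvw => h ?_
      obtain ⟨a, ha⟩ := (Submodule.mem_span_range_iff_exists_fun K).1 hvw.2
      exact ⟨a, hvw.1, ha.symm⟩
    rw [h0]
    constructor
    · intro h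
      exact .inr ⟨h', h⟩
    · rintro (⟨a, h, _⟩ | ⟨_, h⟩)
      · exact (h' a h).elim
      · exact h

theorem VTerm.exists_realize_eq (β : LinearMap.BilinForm K V) {m n : ℕ} (x : Fin m → K)
    (y : Fin n → V) : ∀ v : VTerm m n, ∃ c : Fin n → K, ∑ j, c j • y j = v.realize β x y
  | .var i => ⟨Pi.single i 1, by simp [VTerm.realize, Pi.single_apply, ite_smul]⟩
  | .zero => ⟨0, by simp [VTerm.realize]⟩
  | .neg v => by
    obtain ⟨c, hc⟩ := VTerm.exists_realize_eq β x y v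
    exact ⟨fun j => -c j, by simp [VTerm.realize, ← hc]⟩
  | .add v w => by
    obtain ⟨c, hc⟩ := VTerm.exists_realize_eq β x y v
    obtain ⟨d, hd⟩ := VTerm.exists_realize_eq β x y w
    exact ⟨fun j => c j + d j, by simp [VTerm.realize, ← hc, ← hd, add_smul,
      Finset.sum_add_distrib]⟩
  | .smul s v => by
    obtain ⟨c, hc⟩ := VTerm.exists_realize_eq β x y v
    exact ⟨fun j => s.realize β x y * c j, by simp [VTerm.realize, ← hc, mul_smul,
      Finset.smul_sum]⟩

end Coordinates

/-- `P` defines the value of the term `s` of the field sort from the field data. -/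
def FTerm.DefinedBy {m n : ℕ} (r : ℕ) (s : FTerm m n)
    (P : ∀ (K : Type u) [Field K], (DataIndex m r n → K) → (Unit → K) → Prop) : Prop :=
  UDefRel P ∧ ∀ (K V : Type u) [Field K] [AddCommGroup V] [Module K V]
    (β : LinearMap.BilinForm K V) (x : Fin m → K) (y : Fin n → V) (M : Fin r → Fin n → K),
    Presents M y → ∀ z : Unit → K, P K (formData β x M y) z ↔ z () = s.realize β x y

/-- `P` defines, from the field data, the coefficients of all representations of the value of the
term `v` as a linear combination of the given vectors. -/
def VTerm.DefinedBy {m n : ℕ} (r : ℕ) (v : VTerm m n)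
    (P : ∀ (K : Type u) [Field K], (DataIndex m r n → K) → (Fin n → K) → Prop) : Prop :=
  UDefRel P ∧ ∀ (K V : Type u) [Field K] [AddCommGroup V] [Module K V]
    (β : LinearMap.BilinForm K V) (x : Fin m → K) (y : Fin n → V) (M : Fin r → Fin n → K),
    Presents M y → ∀ c : Fin n → K, P K (formData β x M y) c ↔
      ∑ j, c j • y j = v.realize β x y

theorem VTerm.DefinedBy.exists_iff {m n r : ℕ} {v : VTerm m n}
    {P : ∀ (K : Type u) [Field K], (DataIndex m r n → K) → (Fin n → K) → Prop}
    (h : v.DefinedBy r P) {K V : Type u} [Field K] [AddCommGroup V] [Module K V]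
    {β : LinearMap.BilinForm K V} {x : Fin m → K} {y : Fin n → V} {M : Fin r → Fin n → K}
    (hM : Presents M y) {Q : (Fin n → K) → Prop} {R : Prop}
    (hQ : ∀ c, ∑ j, c j • y j = v.realize β x y → (Q c ↔ R)) :
    (∃ c, P K (formData β x M y) c ∧ Q c) ↔ R := by
  constructor
  · rintro ⟨c, hc, hq⟩
    exact (hQ c ((h.2 K V β x y M hM c).1 hc)).1 hq
  · intro hR
    obtain ⟨c, hc⟩ := VTerm.exists_realize_eq β x y v
    exact ⟨c, (h.2 K V β x y M hM c).2 hc, (hQ c hc).2 hR⟩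

theorem FTerm.DefinedBy.exists_iff {m n r : ℕ} {s : FTerm m n}
    {P : ∀ (K : Type u) [Field K], (DataIndex m r n → K) → (Unit → K) → Prop}
    (h : s.DefinedBy r P) {K V : Type u} [Field K] [AddCommGroup V] [Module K V]
    {β : LinearMap.BilinForm K V} {x : Fin m → K} {y : Fin n → V} {M : Fin r → Fin n → K}
    (hM : Presents M y) {Q : (Unit → K) → Prop} {R : Prop}
    (hQ : ∀ z, z () = s.realize β x y → (Q z ↔ R)) :
    (∃ z, P K (formData β x M y) z ∧ Q z) ↔ R := by
  constructor
  · rintro ⟨c, hc, hq⟩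
    exact (hQ c ((h.2 K V β x y M hM c).1 hc)).1 hq
  · intro hR
    exact ⟨fun _ => s.realize β x y, (h.2 K V β x y M hM _).2 rfl, (hQ _ rfl).2 hR⟩

/-- The vectors with the coefficient tuples `c (j, ·)` are linearly independent, expressed by the
matrix contained in the data `e`. -/
def IndepCoeffs {K : Type u} [Field K] {m r n k : ℕ} (e : DataIndex m r n → K)
    (c : Fin k × Fin n → K) : Prop :=
  ∀ a : Fin k → K, SameVector e (fun l => ∑ j, a j * c (j, l)) (fun _ => 0) → ∀ j, a j = 0

theorem sum_combination_smul {K V : Type u} [Field K] [AddCommGroup V] [Module K V] {n k : ℕ}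
    {y : Fin n → V} {v : Fin k → V} {c : Fin k × Fin n → K}
    (hc : ∀ j, ∑ l, c (j, l) • y l = v j) (a : Fin k → K) :
    ∑ l, (∑ j, a j * c (j, l)) • y l = ∑ j, a j • v j := by
  simp only [Finset.sum_smul, ← hc, Finset.smul_sum, mul_smul]
  exact Finset.sum_comm

theorem Presents.indepCoeffs_iff {K V : Type u} [Field K] [AddCommGroup V] [Module K V]
    {β : LinearMap.BilinForm K V} {m r n k : ℕ} {x : Fin m → K} {M : Fin r → Fin n → K}
    {y : Fin n → V} (h : Presents M y) {v : Fin k → V} {c : Fin k × Fin n → K}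
    (hc : ∀ j, ∑ l, c (j, l) • y l = v j) :
    IndepCoeffs (formData β x M y) c ↔ LinearIndependent K v := by
  rw [Fintype.linearIndependent_iff]
  refine forall_congr' fun a => ?_
  rw [h.sameVector_iff, sum_combination_smul hc]
  simp

theorem UDef.indepCoeffs {γ : Type} {m r n k : ℕ}
    {p : DataIndex m r n → ∀ (K : Type u) [Field K], (γ → K) → K}
    {c : Fin k × Fin n → ∀ (K : Type u) [Field K], (γ → K) → K}
    (hp : ∀ a, UPoly (p a)) (hc : ∀ i, UPoly (c i)) :
    UDef fun K _ x => IndepCoeffs (fun a => p a K x) (fun i => c i K x) := by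
  have h1 := fun (s : γ → γ ⊕ Fin k) (q : ∀ (K : Type u) [Field K], (γ → K) → K)
    (hq : UPoly q) => (show UPoly fun K _ (z : γ ⊕ Fin k → K) => q K fun a => z (.inl a) by
      obtain ⟨t, ht⟩ := hq
      refine ⟨t.relabel Sum.inl, fun K _ z => ?_⟩
      let := Ring.compatibleRingOfRing K
      exact Language.Term.realize_relabel.trans (ht K _))
  refine forall_tuple (imp (sameVector (fun a => h1 .inl _ (hp a)) (fun l => UPoly.sum fun j =>
    (UPoly.var _).mul (h1 .inl _ (hc _))) fun _ => UPoly.zero)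
    (forall_index fun j => eq (UPoly.var _) UPoly.zero))

theorem UPoly.single {γ : Type} {n : ℕ} (i j : Fin n) :
    UPoly.{u} fun K _ (_ : γ → K) => (Pi.single i 1 : Fin n → K) j := by
  by_cases h : j = i
  · subst h
    simpa using UPoly.one
  · simpa [h] using UPoly.zero

mutual

theorem FTerm.exists_definedBy {m n : ℕ} (r : ℕ) :
    ∀ s : FTerm m n, ∃ P, FTerm.DefinedBy.{u} r s P
  | .var i => ⟨fun _ _ e z => z () = e (.inl i), .eq (.var _) (.var _),
      fun K V _ _ _ β x y M hM z => by rw [FTerm.realize]; rfl⟩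
  | .zero => ⟨fun _ _ e z => z () = 0, .eq (.var _) .zero,
      fun K V _ _ _ β x y M hM z => by rw [FTerm.realize]⟩
  | .one => ⟨fun _ _ e z => z () = 1, .eq (.var _) .one,
      fun K V _ _ _ β x y M hM z => by rw [FTerm.realize]⟩
  | .neg s => by
    obtain ⟨P, hP⟩ := FTerm.exists_definedBy r s
    refine ⟨fun K _ e z => ∃ a : Unit → K, P K e a ∧ z () = -a (),
      .exists_tuple (.and (hP.1.subst (fun _ => .var _) fun _ => .var _)
        (.eq (.var _) (.neg (.var _)))),
      fun K V _ _ _ β x y M hM z => hP.exists_iff hM fun a ha => ?_⟩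
    rw [ha, FTerm.realize]
  | .add s t => by
    obtain ⟨P, hP⟩ := FTerm.exists_definedBy r s
    obtain ⟨Q, hQ⟩ := FTerm.exists_definedBy r t
    refine ⟨fun K _ e z => ∃ a : Unit → K, P K e a ∧ ∃ b : Unit → K, Q K e b ∧ z () = a () + b (),
      .exists_tuple (.and (hP.1.subst (fun _ => .var _) fun _ => .var _) (.exists_tuple
        (.and (hQ.1.subst (fun _ => .var _) fun _ => .var _)
          (.eq (.var _) (.add (.var _) (.var _)))))),
      fun K V _ _ _ β x y M hM z => hP.exists_iff hM fun a ha => hQ.exists_iff hM fun b hb => ?_⟩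
    rw [ha, hb, FTerm.realize]
  | .mul s t => by
    obtain ⟨P, hP⟩ := FTerm.exists_definedBy r s
    obtain ⟨Q, hQ⟩ := FTerm.exists_definedBy r t
    refine ⟨fun K _ e z => ∃ a : Unit → K, P K e a ∧ ∃ b : Unit → K, Q K e b ∧ z () = a () * b (),
      .exists_tuple (.and (hP.1.subst (fun _ => .var _) fun _ => .var _) (.exists_tuple
        (.and (hQ.1.subst (fun _ => .var _) fun _ => .var _)
          (.eq (.var _) (.mul (.var _) (.var _)))))),
      fun K V _ _ _ β x y M hM z => hP.exists_iff hM fun a ha => hQ.exists_iff hM fun b hb => ?_⟩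
    rw [ha, hb, FTerm.realize]
  | .coord k i v w => by
    choose P hP using fun j => VTerm.exists_definedBy r (v j)
    obtain ⟨Q, hQ⟩ := VTerm.exists_definedBy r w
    refine ⟨fun K _ e z => ∃ c : Fin k × Fin n → K, (∀ j, P j K e fun l => c (j, l)) ∧
      ∃ d : Fin n → K, Q K e d ∧
      ((∃ a : Fin k → K, (IndepCoeffs e c ∧ SameVector e d fun l => ∑ j, a j * c (j, l)) ∧
          z () = a i) ∨
        (∀ a : Fin k → K, ¬ (IndepCoeffs e c ∧ SameVector e d fun l => ∑ j, a j * c (j, l))) ∧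
          z () = 0),
      .exists_tuple (.and (.forall_index fun j => (hP j).1.subst (fun _ => .var _) fun _ => .var _)
        (.exists_tuple (.and (hQ.1.subst (fun _ => .var _) fun _ => .var _) (.or
          (.exists_tuple (.and (.and (.indepCoeffs (fun _ => .var _) fun _ => .var _)
            (.sameVector (fun _ => .var _) (fun _ => .var _)
              fun _ => .sum fun _ => .mul (.var _) (.var _))) (.eq (.var _) (.var _))))
          (.and (.forall_tuple (.not (.and (.indepCoeffs (fun _ => .var _) fun _ => .var _)
            (.sameVector (fun _ => .var _) (fun _ => .var _)
              fun _ => .sum fun _ => .mul (.var _) (.var _))))) (.eq (.var _) .zero)))))),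
      fun K V _ _ _ β x y M hM z => ?_⟩
    have key : ∀ c : Fin k × Fin n → K, (∀ j, ∑ l, c (j, l) • y l = (v j).realize β x y) →
        ((∃ d : Fin n → K, Q K (formData β x M y) d ∧
          ((∃ a : Fin k → K, (IndepCoeffs (formData β x M y) c ∧
              SameVector (formData β x M y) d fun l => ∑ j, a j * c (j, l)) ∧ z () = a i) ∨
          (∀ a : Fin k → K, ¬ (IndepCoeffs (formData β x M y) c ∧
            SameVector (formData β x M y) d fun l => ∑ j, a j * c (j, l))) ∧ z () = 0)) ↔
        z () = FTerm.realize β x y (.coord k i v w)) := fun c hc =>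
      hQ.exists_iff hM fun d hd => by
        simp only [hM.indepCoeffs_iff hc, hM.sameVector_iff, sum_combination_smul hc, hd]
        rw [FTerm.realize, eq_coordinate_iff]
    constructor
    · rintro ⟨c, hc, h⟩
      exact (key c fun j => ((hP j).2 K V β x y M hM _).1 (hc j)).1 h
    · intro h
      choose c hc using fun j => VTerm.exists_realize_eq β x y (v j)
      exact ⟨fun p => c p.1 p.2, fun j => ((hP j).2 K V β x y M hM _).2 (hc j),
        (key _ hc).2 h⟩
  | .form v w => by
    obtain ⟨P, hP⟩ := VTerm.exists_definedBy r v
    obtain ⟨Q, hQ⟩ := VTerm.exists_definedBy r w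
    refine ⟨fun K _ e z => ∃ c : Fin n → K, P K e c ∧ ∃ d : Fin n → K, Q K e d ∧
      z () = ∑ i, ∑ j, c i * (d j * e (.inr (.inr (i, j)))),
      .exists_tuple (.and (hP.1.subst (fun _ => .var _) fun _ => .var _) (.exists_tuple
        (.and (hQ.1.subst (fun _ => .var _) fun _ => .var _)
          (.eq (.var _) (.sum fun _ => .sum fun _ => .mul (.var _) (.mul (.var _) (.var _))))))),
      fun K V _ _ _ β x y M hM z => hP.exists_iff hM fun c hc => hQ.exists_iff hM fun d hd => ?_⟩
    rw [FTerm.realize, ← hc, ← hd]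
    simp only [formData, dataTuple, Sum.elim_inr, map_sum, LinearMap.sum_apply, map_smul,
      LinearMap.smul_apply, smul_eq_mul]
    rw [Finset.sum_comm]
    simp only [Finset.mul_sum, mul_left_comm]

theorem VTerm.exists_definedBy {m n : ℕ} (r : ℕ) :
    ∀ v : VTerm m n, ∃ P, VTerm.DefinedBy.{u} r v P
  | .var i => ⟨fun K _ e c => SameVector e c (Pi.single i 1),
      .sameVector (fun _ => .var _) (fun _ => .var _) (fun _ => .single _ _),
      fun K V _ _ _ β x y M hM c => by
        beta_reduce
        rw [hM.sameVector_iff, VTerm.realize]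
        simp [Pi.single_apply, ite_smul]⟩
  | .zero => ⟨fun K _ e c => SameVector e c fun _ => 0,
      .sameVector (fun _ => .var _) (fun _ => .var _) (fun _ => .zero),
      fun K V _ _ _ β x y M hM c => by
        beta_reduce
        rw [hM.sameVector_iff, VTerm.realize]
        simp⟩
  | .neg v => by
    obtain ⟨P, hP⟩ := VTerm.exists_definedBy r v
    refine ⟨fun K _ e c => ∃ a : Fin n → K, P K e a ∧ SameVector e c fun j => -a j,
      .exists_tuple (.and (hP.1.subst (fun _ => .var _) fun _ => .var _)
        (.sameVector (fun _ => .var _) (fun _ => .var _) fun _ => .neg (.var _))),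
      fun K V _ _ _ β x y M hM c => hP.exists_iff hM fun a ha => ?_⟩
    rw [hM.sameVector_iff, VTerm.realize, ← ha]
    simp
  | .add v w => by
    obtain ⟨P, hP⟩ := VTerm.exists_definedBy r v
    obtain ⟨Q, hQ⟩ := VTerm.exists_definedBy r w
    refine ⟨fun K _ e c => ∃ a : Fin n → K, P K e a ∧ ∃ b : Fin n → K, Q K e b ∧
      SameVector e c fun j => a j + b j,
      .exists_tuple (.and (hP.1.subst (fun _ => .var _) fun _ => .var _) (.exists_tuple
        (.and (hQ.1.subst (fun _ => .var _) fun _ => .var _)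
          (.sameVector (fun _ => .var _) (fun _ => .var _) fun _ => .add (.var _) (.var _))))),
      fun K V _ _ _ β x y M hM c => hP.exists_iff hM fun a ha => hQ.exists_iff hM fun b hb => ?_⟩
    rw [hM.sameVector_iff, VTerm.realize, ← ha, ← hb]
    simp [add_smul, Finset.sum_add_distrib]
  | .smul s v => by
    obtain ⟨P, hP⟩ := FTerm.exists_definedBy r s
    obtain ⟨Q, hQ⟩ := VTerm.exists_definedBy r v
    refine ⟨fun K _ e c => ∃ a : Unit → K, P K e a ∧ ∃ b : Fin n → K, Q K e b ∧
      SameVector e c fun j => a () * b j,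
      .exists_tuple (.and (hP.1.subst (fun _ => .var _) fun _ => .var _) (.exists_tuple
        (.and (hQ.1.subst (fun _ => .var _) fun _ => .var _)
          (.sameVector (fun _ => .var _) (fun _ => .var _) fun _ => .mul (.var _) (.var _))))),
      fun K V _ _ _ β x y M hM c => hP.exists_iff hM fun a ha => hQ.exists_iff hM fun b hb => ?_⟩
    rw [hM.sameVector_iff, VTerm.realize, ← ha, ← hb]
    simp [mul_smul, Finset.smul_sum]

end

/-! ### Field data of a tuple extended by one element -/

section Extension

variable {K V : Type u} [Field K] [AddCommGroup V] [Module K V] {m r n : ℕ}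

theorem Presents.snoc_of_mem_span {M : Fin r → Fin n → K} {y : Fin n → V} (h : Presents M y)
    (a : Fin n → K) :
    Presents (fun i => Fin.snoc (M i) (∑ j, M i j * a j) : Fin r → Fin (n + 1) → K)
      (Fin.snoc y (∑ j, a j • y j) : Fin (n + 1) → V) := by
  intro c
  have := h fun j => c j.castSucc + a j * c (Fin.last n)
  simp only [Fin.sum_univ_castSucc, Fin.snoc_castSucc, Fin.snoc_last]
  simp only [mul_add, add_smul, Finset.sum_add_distrib, ← mul_assoc, ← Finset.sum_mul] at this
  rw [this, Finset.smul_sum]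
  simp only [smul_smul, mul_comm]

theorem Presents.snoc_of_notMem_span {M : Fin r → Fin n → K} {y : Fin n → V} (h : Presents M y)
    {v : V} (hv : v ∉ Submodule.span K (Set.range y)) :
    Presents (Fin.snoc (fun i => Fin.snoc (M i) 0 : Fin r → Fin (n + 1) → K)
      (Fin.snoc (fun _ => 0) 1 : Fin (n + 1) → K) : Fin (r + 1) → Fin (n + 1) → K)
      (Fin.snoc y v : Fin (n + 1) → V) := by
  intro c
  simp only [Fin.forall_fin_succ', Fin.sum_univ_castSucc, Fin.snoc_castSucc, Fin.snoc_last,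
    zero_mul, add_zero, Finset.sum_const_zero, one_mul, zero_add]
  rw [h fun j => c j.castSucc]
  constructor
  · rintro ⟨h1, h2⟩
    rw [h1, h2, zero_smul, add_zero]
  · intro h1
    have h2 : c (Fin.last n) = 0 := by
      by_contra h0
      refine hv ?_
      rw [← Submodule.smul_mem_iff _ h0, eq_neg_of_add_eq_zero_right h1]
      exact Submodule.neg_mem _ (Submodule.sum_mem _ fun j _ =>
        Submodule.smul_mem _ _ (Submodule.subset_span ⟨j, rfl⟩))
    refine ⟨?_, h2⟩
    rwa [h2, zero_smul, add_zero] at h1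

/-- The field data after extending the tuple of field elements by `a`. -/
def fieldExt (e : DataIndex m r n → K) (a : K) : DataIndex (m + 1) r n → K :=
  Sum.elim (Fin.snoc (fun i => e (.inl i)) a : Fin (m + 1) → K) fun p => e (.inr p)

/-- The field data after extending the tuple of vectors by its linear combination with
coefficients `a`. -/
def spanExt (e : DataIndex m r n → K) (a : Fin n → K) : DataIndex m r (n + 1) → K :=
  dataTuple (fun i => e (.inl i))
    (fun i => (Fin.snoc (fun j => e (.inr (.inl (i, j))))
      (∑ j, e (.inr (.inl (i, j))) * a j) : Fin (n + 1) → K))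
    (Fin.snoc (fun i => (Fin.snoc (fun j => e (.inr (.inr (i, j))))
        (∑ j, a j * e (.inr (.inr (i, j)))) : Fin (n + 1) → K))
      (Fin.snoc (fun j => ∑ i, a i * e (.inr (.inr (i, j))))
        (∑ i, ∑ j, a i * (a j * e (.inr (.inr (i, j))))) : Fin (n + 1) → K) :
      Fin (n + 1) → Fin (n + 1) → K)

/-- The value `β w v` of a form of the given kind in terms of the value `b = β v w`. -/
def FormKind.swap (b : K) : FormKind → K
  | .symmetric => b
  | .alternating => -b

/-- The condition on `s` to be a value `β v v` of a form of the given kind. -/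
def FormKind.IsDiagonalValue (s : K) : FormKind → Prop
  | .symmetric => True
  | .alternating => s = 0

theorem FormKind.Holds.swap_eq {β : LinearMap.BilinForm K V} {κ : FormKind} (h : κ.Holds β)
    (v w : V) : κ.swap (β v w) = β w v := by
  cases κ with
  | symmetric => exact LinearMap.BilinForm.IsSymm.eq h v w
  | alternating => exact LinearMap.BilinForm.IsAlt.neg_eq h v w

theorem FormKind.Holds.isDiagonalValue {β : LinearMap.BilinForm K V} {κ : FormKind}
    (h : κ.Holds β) (v : V) : κ.IsDiagonalValue (β v v) := by
  cases κ with
  | symmetric => trivial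
  | alternating => exact h v

/-- The field data after extending the tuple of vectors by a vector `v` outside its span, where
`b` lists the values `β (y i) v` and `s` is `β v v`. -/
def freeExt (κ : FormKind) (e : DataIndex m r n → K) (b : Fin n → K) (s : K) :
    DataIndex m (r + 1) (n + 1) → K :=
  dataTuple (fun i => e (.inl i))
    (Fin.snoc (fun i => Fin.snoc (fun j => e (.inr (.inl (i, j)))) 0 : Fin r → Fin (n + 1) → K)
      (Fin.snoc (fun _ => 0) 1 : Fin (n + 1) → K) : Fin (r + 1) → Fin (n + 1) → K)
    (Fin.snoc (fun i => Fin.snoc (fun j => e (.inr (.inr (i, j)))) (b i) :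
        Fin n → Fin (n + 1) → K)
      (Fin.snoc (fun j => κ.swap (b j)) s : Fin (n + 1) → K) : Fin (n + 1) → Fin (n + 1) → K)

theorem formData_snoc_left (β : LinearMap.BilinForm K V) (x : Fin m → K)
    (M : Fin r → Fin n → K) (y : Fin n → V) (a : K) :
    formData β (Fin.snoc x a : Fin (m + 1) → K) M y = fieldExt (formData β x M y) a := by
  funext i
  rcases i with i | i
  · rfl
  · rfl

theorem formData_snoc_of_mem_span (β : LinearMap.BilinForm K V) (x : Fin m → K)
    (M : Fin r → Fin n → K) (y : Fin n → V) (a : Fin n → K) :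
    formData β x (fun i => Fin.snoc (M i) (∑ j, M i j * a j) : Fin r → Fin (n + 1) → K)
      (Fin.snoc y (∑ j, a j • y j) : Fin (n + 1) → V) = spanExt (formData β x M y) a := by
  funext i
  rcases i with i | ⟨i, j⟩ | ⟨i, j⟩
  · rfl
  · rfl
  · simp only [formData, dataTuple, spanExt, Sum.elim_inr]
    refine Fin.lastCases ?_ (fun i => ?_) i <;> refine Fin.lastCases ?_ (fun j => ?_) j <;>
      simp [Finset.mul_sum]
    rw [Finset.sum_comm]
    simp only [mul_left_comm]

theorem formData_snoc_of_notMem_span {κ : FormKind} {β : LinearMap.BilinForm K V}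
    (hβ : κ.Holds β) (x : Fin m → K) (M : Fin r → Fin n → K) (y : Fin n → V) (v : V) :
    formData β x (Fin.snoc (fun i => Fin.snoc (M i) 0 : Fin r → Fin (n + 1) → K)
      (Fin.snoc (fun _ => 0) 1 : Fin (n + 1) → K) : Fin (r + 1) → Fin (n + 1) → K)
      (Fin.snoc y v : Fin (n + 1) → V) =
    freeExt κ (formData β x M y) (fun i => β (y i) v) (β v v) := by
  funext i
  rcases i with i | ⟨i, j⟩ | ⟨i, j⟩
  · rfl
  · rfl
  · simp only [formData, dataTuple, freeExt, Sum.elim_inr]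
    refine Fin.lastCases ?_ (fun i => ?_) i <;> refine Fin.lastCases ?_ (fun j => ?_) j <;>
      simp [hβ.swap_eq]

end Extension

section Definability

variable {γ : Type} {m r n : ℕ}

theorem UPoly.snoc {p : Fin n → ∀ (K : Type u) [Field K], (γ → K) → K}
    {q : ∀ (K : Type u) [Field K], (γ → K) → K} (hp : ∀ i, UPoly (p i)) (hq : UPoly q)
    (i : Fin (n + 1)) :
    UPoly fun K _ z => (Fin.snoc (fun j => p j K z) (q K z) : Fin (n + 1) → K) i := by
  refine Fin.lastCases ?_ (fun i => ?_) i
  · simpa using hq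
  · simpa using hp i

theorem UPoly.snoc_row {k : ℕ} {p : Fin n → ∀ (K : Type u) [Field K], (γ → K) → Fin k → K}
    {q : ∀ (K : Type u) [Field K], (γ → K) → Fin k → K} {j : Fin k}
    (hp : ∀ i, UPoly fun K _ z => p i K z j) (hq : UPoly fun K _ z => q K z j)
    (i : Fin (n + 1)) :
    UPoly fun K _ z => (Fin.snoc (fun j => p j K z) (q K z) : Fin (n + 1) → Fin k → K) i j := by
  refine Fin.lastCases ?_ (fun i => ?_) i
  · simpa using hq
  · simpa using hp i

theorem UPoly.fieldExt {e : DataIndex m r n → ∀ (K : Type u) [Field K], (γ → K) → K}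
    {a : ∀ (K : Type u) [Field K], (γ → K) → K} (he : ∀ p, UPoly (e p)) (ha : UPoly a)
    (i : DataIndex (m + 1) r n) :
    UPoly fun K _ z => Granger.fieldExt (fun p => e p K z) (a K z) i := by
  rcases i with i | i
  · exact snoc (fun i => he _) ha i
  · exact he _

theorem UPoly.spanExt {e : DataIndex m r n → ∀ (K : Type u) [Field K], (γ → K) → K}
    {a : Fin n → ∀ (K : Type u) [Field K], (γ → K) → K} (he : ∀ p, UPoly (e p))
    (ha : ∀ i, UPoly (a i)) (i : DataIndex m r (n + 1)) :
    UPoly fun K _ z => Granger.spanExt (fun p => e p K z) (fun i => a i K z) i := by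
  rcases i with i | ⟨i, j⟩ | ⟨i, j⟩
  · exact he _
  · simp only [Granger.spanExt, dataTuple, Sum.elim_inl, Sum.elim_inr]
    exact snoc (fun _ => he _) (.sum fun _ => .mul (he _) (ha _)) j
  · simp only [Granger.spanExt, dataTuple, Sum.elim_inr]
    exact snoc_row (fun _ => snoc (fun _ => he _) (.sum fun _ => .mul (ha _) (he _)) j)
      (snoc (fun _ => .sum fun _ => .mul (ha _) (he _))
        (.sum fun _ => .sum fun _ => .mul (ha _) (.mul (ha _) (he _))) j) i

theorem UPoly.freeExt (κ : FormKind)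
    {e : DataIndex m r n → ∀ (K : Type u) [Field K], (γ → K) → K}
    {b : Fin n → ∀ (K : Type u) [Field K], (γ → K) → K}
    {s : ∀ (K : Type u) [Field K], (γ → K) → K} (he : ∀ p, UPoly (e p))
    (hb : ∀ i, UPoly (b i)) (hs : UPoly s) (i : DataIndex m (r + 1) (n + 1)) :
    UPoly fun K _ z => Granger.freeExt κ (fun p => e p K z) (fun i => b i K z) (s K z) i := by
  rcases i with i | ⟨i, j⟩ | ⟨i, j⟩
  · exact he _
  · simp only [Granger.freeExt, dataTuple, Sum.elim_inl, Sum.elim_inr]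
    exact snoc_row (fun _ => snoc (fun _ => he _) .zero j) (snoc (fun _ => .zero) .one j) i
  · simp only [Granger.freeExt, dataTuple, Sum.elim_inr]
    refine snoc_row (fun _ => snoc (fun _ => he _) (hb _) j) (snoc (fun i => ?_) hs j) i
    cases κ with
    | symmetric => exact hb i
    | alternating => exact (hb i).neg

theorem UDef.isDiagonalValue (κ : FormKind) {s : ∀ (K : Type u) [Field K], (γ → K) → K}
    (hs : UPoly s) : UDef fun K _ z => κ.IsDiagonalValue (s K z) := by
  cases κ with
  | symmetric =>
    have h : UDef.{u} (α := γ) fun _ _ _ => True := by simpa using false.not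
    exact h
  | alternating => exact .eq hs .zero

end Definability

/-- The linear relations recorded by the matrix in the data `e` are also relations between the
field elements `b`. -/
def Compatible {K : Type u} [Field K] {m r n : ℕ} (e : DataIndex m r n → K) (b : Fin n → K) :
    Prop :=
  ∀ c : Fin n → K, (∀ i, ∑ j, e (.inr (.inl (i, j))) * c j = 0) → ∑ j, c j * b j = 0

/-! ### Elimination of quantifiers -/

section Elimination

variable {κ : FormKind} {T₀ : Language.ring.Theory}

/-- In models of the theory, the values on the field data of a vector `v` outside the span of
finitely many given vectors are subject to no conditions but the evident ones. -/
theorem IsModel.exists_notMem_span (hT₀ : IsCompletionOf T₀ PSFNeTwo) {K V : Type u} [Field K]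
    [AddCommGroup V] [Module K V] {β : LinearMap.BilinForm K V} (h : IsModel κ T₀ K V β) {n : ℕ}
    (y : Fin n → V) (b : Fin n → K)
    (hb : ∀ c : Fin n → K, ∑ i, c i • y i = 0 → ∑ i, c i * b i = 0) {s : K}
    (hs : κ.IsDiagonalValue s) :
    ∃ v, v ∉ Submodule.span K (Set.range y) ∧ (∀ i, β (y i) v = b i) ∧ β v v = s := by
  cases κ with
  | symmetric =>
    have h2 := (fieldSatisfies_charNeTwo K).1 (hT₀.fieldSatisfies h.field_models charNeTwo_mem)
    have hu := (fieldSatisfies_binaryFormsUniversal K).1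
      (hT₀.fieldSatisfies h.field_models binaryFormsUniversal_mem)
    exact exists_notMem_span_of_isSymm h.infinite_dimensional h.nondegenerate h.kind
      (by rwa [← one_add_one_eq_two]) (fun a b c ha hb => hu a b c ha hb h2) y b hb s
  | alternating =>
    obtain ⟨v, hv, hvb⟩ :=
      exists_notMem_span_of_nondegenerate h.infinite_dimensional h.nondegenerate y b hb
    exact ⟨v, hv, hvb, (h.kind v).trans (Eq.symm hs)⟩

/-- In models of the theory, the truth value of `φ` is defined by `P` from the field data. -/
def Formula.DefinedBy (κ : FormKind) (T₀ : Language.ring.Theory) {m n : ℕ} (r : ℕ)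
    (φ : Formula m n) (P : ∀ (K : Type u) [Field K], (DataIndex m r n → K) → Prop) : Prop :=
  UDef P ∧ ∀ (K V : Type u) [Field K] [AddCommGroup V] [Module K V]
    (β : LinearMap.BilinForm K V), IsModel κ T₀ K V β → ∀ (x : Fin m → K) (y : Fin n → V)
    (M : Fin r → Fin n → K), Presents M y → (P K (formData β x M y) ↔ φ.Realize β x y)

theorem Formula.exists_definedBy (hT₀ : IsCompletionOf T₀ PSFNeTwo) :
    ∀ {m n : ℕ} (φ : Formula m n) (r : ℕ), ∃ P, Formula.DefinedBy.{u} κ T₀ r φ P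
  | _, _, .falsum, r => ⟨fun _ _ _ => False, .false, fun _ _ _ _ _ _ _ _ _ _ _ => Iff.rfl⟩
  | m, n, .eqF s t, r => by
    obtain ⟨P, hP⟩ := FTerm.exists_definedBy r s
    obtain ⟨Q, hQ⟩ := FTerm.exists_definedBy r t
    refine ⟨fun K _ e => ∃ a : Unit → K, P K e a ∧ ∃ b : Unit → K, Q K e b ∧ a () = b (),
      .exists_tuple (.and (hP.1.subst (fun _ => .var _) fun _ => .var _) (.exists_tuple
        (.and (hQ.1.subst (fun _ => .var _) fun _ => .var _) (.eq (.var _) (.var _))))),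
      fun K V _ _ _ β _ x y M hM => hP.exists_iff hM fun a ha => hQ.exists_iff hM fun b hb => ?_⟩
    rw [ha, hb, Formula.Realize]
  | m, n, .eqV v w, r => by
    obtain ⟨P, hP⟩ := VTerm.exists_definedBy r v
    obtain ⟨Q, hQ⟩ := VTerm.exists_definedBy r w
    refine ⟨fun K _ e => ∃ a : Fin n → K, P K e a ∧ ∃ b : Fin n → K, Q K e b ∧ SameVector e a b,
      .exists_tuple (.and (hP.1.subst (fun _ => .var _) fun _ => .var _) (.exists_tuple
        (.and (hQ.1.subst (fun _ => .var _) fun _ => .var _)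
          (.sameVector (fun _ => .var _) (fun _ => .var _) fun _ => .var _)))),
      fun K V _ _ _ β _ x y M hM => hP.exists_iff hM fun a ha => hQ.exists_iff hM fun b hb => ?_⟩
    rw [hM.sameVector_iff, ha, hb, Formula.Realize]
  | m, n, .indep k v, r => by
    choose P hP using fun j => VTerm.exists_definedBy r (v j)
    refine ⟨fun K _ e => ∃ c : Fin (k + 1) × Fin n → K, (∀ j, P j K e fun l => c (j, l)) ∧
        IndepCoeffs e c,
      .exists_tuple (.and (.forall_index fun j => (hP j).1.subst (fun _ => .var _) fun _ => .var _)
        (.indepCoeffs (fun _ => .var _) fun _ => .var _)),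
      fun K V _ _ _ β _ x y M hM => ?_⟩
    rw [Formula.Realize]
    constructor
    · rintro ⟨c, hc, h⟩
      exact (hM.indepCoeffs_iff fun j => ((hP j).2 K V β x y M hM _).1 (hc j)).1 h
    · intro h
      choose c hc using fun j => VTerm.exists_realize_eq β x y (v j)
      exact ⟨fun p => c p.1 p.2, fun j => ((hP j).2 K V β x y M hM _).2 (hc j),
        (hM.indepCoeffs_iff hc).2 h⟩
  | m, n, .imp φ ψ, r => by
    obtain ⟨P, hP⟩ := Formula.exists_definedBy hT₀ φ r
    obtain ⟨Q, hQ⟩ := Formula.exists_definedBy hT₀ ψ r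
    exact ⟨fun K _ e => P K e → Q K e, hP.1.imp hQ.1, fun K V _ _ _ β hβ x y M hM =>
      imp_congr (hP.2 K V β hβ x y M hM) (hQ.2 K V β hβ x y M hM)⟩
  | m, n, .allF φ, r => by
    obtain ⟨P, hP⟩ := Formula.exists_definedBy hT₀ φ r
    refine ⟨fun K _ e => ∀ a : Unit → K, P K (fieldExt e (a ())),
      .forall_tuple (hP.1.comp fun i => .fieldExt (fun _ => .var _) (.var _) i),
      fun K V _ _ _ β hβ x y M hM => ?_⟩
    simp only [← formData_snoc_left, hP.2 K V β hβ _ y M hM]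
    exact ⟨fun h a => h fun _ => a, fun h a => h (a ())⟩
  | m, n, .allV φ, r => by
    obtain ⟨P, hP⟩ := Formula.exists_definedBy hT₀ φ r
    obtain ⟨Q, hQ⟩ := Formula.exists_definedBy hT₀ φ (r + 1)
    -- the quantified vector lies in the span of the given ones, or it is free over them
    refine ⟨fun K _ e => (∀ a : Fin n → K, P K (spanExt e a)) ∧
        ∀ b : Fin n → K, ∀ s : Unit → K, Compatible e b → κ.IsDiagonalValue (s ()) →
          Q K (freeExt κ e b (s ())),
      .and (.forall_tuple (hP.1.comp fun i => .spanExt (fun _ => .var _) (fun _ => .var _) i))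
        (.forall_tuple (.forall_tuple (.imp
          (.forall_tuple (.imp
            (.forall_index fun i => .eq (.sum fun j => .mul (.var _) (.var _)) .zero)
            (.eq (.sum fun j => .mul (.var _) (.var _)) .zero)))
          (.imp (.isDiagonalValue κ (.var _))
            (hQ.1.comp fun i => .freeExt κ (fun _ => .var _) (fun _ => .var _) (.var _) i))))),
      fun K V _ _ _ β hβ x y M hM => ?_⟩
    have hP' (a : Fin n → K) := formData_snoc_of_mem_span β x M y a ▸
      hP.2 K V β hβ x _ _ (hM.snoc_of_mem_span a)
    have hQ' (v : V) (hv : v ∉ Submodule.span K (Set.range y)) :=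
      formData_snoc_of_notMem_span hβ.kind x M y v ▸
        hQ.2 K V β hβ x _ _ (hM.snoc_of_notMem_span hv)
    constructor
    · rintro ⟨h1, h2⟩ v
      by_cases hv : v ∈ Submodule.span K (Set.range y)
      · obtain ⟨a, rfl⟩ := (Submodule.mem_span_range_iff_exists_fun K).1 hv
        exact (hP' a).1 (h1 a)
      · refine (hQ' v hv).1 (h2 _ (fun _ => β v v) (fun c hc => ?_) (hβ.kind.isDiagonalValue v))
        have := congrArg (fun w => β w v) ((hM c).1 hc)
        simpa using this
    · refine fun h => ⟨fun a => (hP' a).2 (h _), fun b s hb hs => ?_⟩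
      obtain ⟨v, hv, hvb, hvs⟩ :=
        hβ.exists_notMem_span hT₀ y b (fun c hc => hb c ((hM c).2 hc)) hs
      obtain rfl : (fun i => β (y i) v) = b := funext hvb
      rw [← hvs]
      exact (hQ' v hv).2 (h v)

end Elimination

/-! ### Terms for a matrix of linear relations -/

section RelationMatrix

/-- The subfamily of the variables of the vector space sort with indices in `S`, in increasing
order. -/
def subfamily {m n : ℕ} (S : Finset (Fin n)) (i : Fin S.card) : VTerm m n :=
  .var (S.orderEmbOfFin rfl i)

/-- A term with value `1` if the variables with indices in `S` are linearly independent, and `0`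
otherwise: the first coordinate of the first of them. -/
def indepTerm {m n : ℕ} (S : Finset (Fin n)) : FTerm m n :=
  if h : 0 < S.card then .coord S.card ⟨0, h⟩ (subfamily S) (subfamily S ⟨0, h⟩) else .one

/-- The product of finitely many terms. -/
def prodTerm {m n : ℕ} : (k : ℕ) → (Fin k → FTerm m n) → FTerm m n
  | 0, _ => .one
  | k + 1, t => .mul (prodTerm k fun i => t i.castSucc) (t (Fin.last k))

/-- A term with value `1` if `S` is a maximal index set of linearly independent variables, and `0`
otherwise. -/
def basisTerm {m n : ℕ} (S : Finset (Fin n)) : FTerm m n :=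
  .mul (indepTerm S)
    (prodTerm n fun j => if j ∈ S then .one else .add .one (.neg (indepTerm (insert j S))))

/-- The row indices of the matrix of linear relations: a potential basis and one of its elements. -/
abbrev RowIndex (n : ℕ) : Type := Σ S : Finset (Fin n), Fin S.card

/-- The entries of the matrix of linear relations: coordinates with respect to `S`, made zero
unless `S` indexes a basis of the span. -/
def relationTerm {m n : ℕ} (p : RowIndex n) (j : Fin n) : FTerm m n :=
  .mul (basisTerm p.1) (.coord p.1.card p.2 (subfamily p.1) (.var j))

variable {K V : Type u} [Field K] [AddCommGroup V] [Module K V]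

open Classical in
/-- The values of the terms `relationTerm`. -/
noncomputable def relationMatrix {n : ℕ} (y : Fin n → V) (p : RowIndex n) (j : Fin n) : K :=
  if LinearIndepOn K y (p.1 : Set (Fin n)) ∧ ∀ j, y j ∈ Submodule.span K (y '' p.1) then
    coordinate (fun i => y (p.1.orderEmbOfFin rfl i)) (y j) p.2
  else 0

theorem linearIndependent_orderEmbOfFin {n : ℕ} (y : Fin n → V) (S : Finset (Fin n)) :
    LinearIndependent K (fun i => y (S.orderEmbOfFin rfl i)) ↔
      LinearIndepOn K y (S : Set (Fin n)) :=
  linearIndependent_equiv (S.orderIsoOfFin rfl).toEquiv (f := fun i : S => y i)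

variable (β : LinearMap.BilinForm K V) {m n : ℕ} (x : Fin m → K) (y : Fin n → V)

open Classical in
theorem realize_indepTerm (S : Finset (Fin n)) :
    (indepTerm S : FTerm m n).realize β x y =
      if LinearIndepOn K y (S : Set (Fin n)) then 1 else 0 := by
  rw [indepTerm]
  split_ifs with h h' h'
  · have hv := (linearIndependent_orderEmbOfFin y S).2 h'
    have := coordinate_eq hv (Pi.single ⟨0, h⟩ 1) ⟨0, h⟩
    simpa [FTerm.realize, subfamily, VTerm.realize, Pi.single_apply, ite_smul] using this
  · rw [FTerm.realize]
    refine dif_neg fun hv => h' ((linearIndependent_orderEmbOfFin y S).1 ?_)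
    simpa [subfamily, VTerm.realize] using hv.1
  · rw [FTerm.realize]
  · obtain rfl : S = ∅ := by simpa using h
    simp at h'

theorem realize_prodTerm : ∀ (k : ℕ) (t : Fin k → FTerm m n),
    (prodTerm k t).realize β x y = ∏ i, (t i).realize β x y
  | 0, t => by simp [prodTerm, FTerm.realize]
  | k + 1, t => by
    simp [prodTerm, FTerm.realize, Fin.prod_univ_castSucc, realize_prodTerm k]

open Classical in
theorem realize_basisTerm (S : Finset (Fin n)) :
    (basisTerm S : FTerm m n).realize β x y =
      if LinearIndepOn K y (S : Set (Fin n)) ∧ ∀ j, y j ∈ Submodule.span K (y '' S) then 1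
      else 0 := by
  rw [basisTerm, FTerm.realize, realize_indepTerm, realize_prodTerm]
  by_cases h : LinearIndepOn K y (S : Set (Fin n))
  · have hj (j : Fin n) : (if j ∈ S then .one else
        .add .one (.neg (indepTerm (insert j S))) : FTerm m n).realize β x y =
        if y j ∈ Submodule.span K (y '' S) then 1 else 0 := by
      by_cases hjS : j ∈ S
      · have : y j ∈ Submodule.span K (y '' S) := Submodule.subset_span ⟨j, hjS, rfl⟩
        simp [hjS, this, FTerm.realize]
      · have := linearIndepOn_insert (K := K) (f := y) (a := j) (s := (S : Set (Fin n))) hjS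
        rw [if_neg hjS, FTerm.realize, FTerm.realize, FTerm.realize, realize_indepTerm,
          Finset.coe_insert, this]
        by_cases hs : y j ∈ Submodule.span K (y '' S) <;> simp [h, hs]
    simp only [hj, Finset.prod_ite_zero, Finset.prod_const_one, h, true_and, if_true, one_mul,
      Finset.mem_univ, forall_true_left]
  · simp [h]

theorem realize_relationTerm (p : RowIndex n) (j : Fin n) :
    (relationTerm p j : FTerm m n).realize β x y = relationMatrix y p j := by
  rw [relationTerm, FTerm.realize, FTerm.realize, realize_basisTerm, relationMatrix]
  split_ifs <;> simp [subfamily, VTerm.realize]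

theorem presents_relationMatrix {r : ℕ} (e : Fin r ≃ RowIndex n) :
    Presents (fun i => relationMatrix (K := K) y (e i)) y := by
  classical
  intro c
  rw [e.forall_congr_left]
  simp only [Equiv.apply_symm_apply]
  -- for a basis `S`, the sums on the left are the coordinates of the vector on the right
  have key (S : Finset (Fin n)) (hS : LinearIndepOn K y (S : Set (Fin n)) ∧
      ∀ j, y j ∈ Submodule.span K (y '' S)) :
      ∑ j, c j • y j = ∑ i, (∑ j, relationMatrix y ⟨S, i⟩ j * c j) •
        y (S.orderEmbOfFin rfl i) := by
    have hv := (linearIndependent_orderEmbOfFin y S).2 hS.1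
    have hr : Set.range (fun i => y (S.orderEmbOfFin rfl i)) = y '' S := by
      rw [← Finset.range_orderEmbOfFin S rfl, ← Set.range_comp]
      rfl
    have hj (j : Fin n) :
        ∑ i, (relationMatrix y ⟨S, i⟩ j : K) • y (S.orderEmbOfFin rfl i) = y j := by
      simp only [relationMatrix, if_pos hS]
      obtain ⟨a, ha⟩ := (Submodule.mem_span_range_iff_exists_fun K).1 (hr ▸ hS.2 j)
      rw [← ha]
      simp only [coordinate_eq hv]
    simp only [Finset.sum_smul]
    rw [Finset.sum_comm]
    refine Finset.sum_congr rfl fun j _ => ?_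
    rw [← hj j, Finset.smul_sum]
    simp only [smul_smul, mul_comm]
  constructor
  · intro h
    obtain ⟨b, -, -, hspan, hb⟩ := exists_linearIndepOn_extension
      (linearIndepOn_empty K y) (Set.subset_univ _)
    rw [key b.toFinset ⟨by simpa using hb, fun j => by
      simpa using hspan ⟨j, trivial, rfl⟩⟩]
    simp [h]
  · rintro h ⟨S, i⟩
    by_cases hS : LinearIndepOn K y (S : Set (Fin n)) ∧ ∀ j, y j ∈ Submodule.span K (y '' S)
    · rw [key S hS] at h
      exact Fintype.linearIndependent_iff.1 ((linearIndependent_orderEmbOfFin y S).2 hS.1) _ h i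
    · simp [relationMatrix, hS]

end RelationMatrix

/-! ### Translation of field formulas -/

/-- The number of rows of the matrix of linear relations. -/
abbrev rowCount (n : ℕ) : ℕ := Fintype.card (RowIndex n)

/-- The field data of a tuple of vectors, with the matrix of linear relations given by terms. -/
noncomputable def canonicalData {K V : Type u} [Field K] [AddCommGroup V] [Module K V]
    (β : LinearMap.BilinForm K V) {m n : ℕ} (x : Fin m → K) (y : Fin n → V) :
    DataIndex m (rowCount n) n → K :=
  formData β x (fun i => relationMatrix y ((Fintype.equivFin (RowIndex n)).symm i)) y

/-- Terms for the entries of the field data, where the `m` variables of the field sort are renamed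
along `f`. -/
noncomputable def dataTerm {m m' n : ℕ} (f : Fin m → Fin m') :
    DataIndex m (rowCount n) n → FTerm m' n :=
  Sum.elim (fun i => .var (f i))
    (Sum.elim (fun p => relationTerm ((Fintype.equivFin (RowIndex n)).symm p.1) p.2)
      fun p => .form (.var p.1) (.var p.2))

theorem realize_dataTerm {K V : Type u} [Field K] [AddCommGroup V] [Module K V]
    (β : LinearMap.BilinForm K V) {m m' n : ℕ} (f : Fin m → Fin m') (x : Fin m' → K)
    (y : Fin n → V) (i : DataIndex m (rowCount n) n) :
    (dataTerm f i).realize β x y = canonicalData β (fun j => x (f j)) y i := by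
  rcases i with i | p | p
  · simp [dataTerm, canonicalData, formData, dataTuple, FTerm.realize]
  · simp [dataTerm, canonicalData, formData, dataTuple, realize_relationTerm]
  · simp [dataTerm, canonicalData, formData, dataTuple, FTerm.realize, VTerm.realize]

theorem exists_term_of_ringTerm {m n l : ℕ}
    (t : Language.ring.Term (DataIndex m (rowCount n) n ⊕ Fin l)) :
    ∃ s : FTerm (m + l) n, ∀ (K V : Type u) [Field K] [AddCommGroup V] [Module K V]
      (β : LinearMap.BilinForm K V) (x : Fin (m + l) → K) (y : Fin n → V),
      letI := Ring.compatibleRingOfRing K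
      s.realize β x y = t.realize (Sum.elim
        (canonicalData β (fun j => x (Fin.castAdd l j)) y) fun j => x (Fin.natAdd m j)) := by
  induction t with
  | var a =>
    rcases a with a | a
    · exact ⟨dataTerm (Fin.castAdd l) a, fun K V _ _ _ β x y => realize_dataTerm β _ x y a⟩
    · exact ⟨.var (Fin.natAdd m a), fun K V _ _ _ β x y => by rw [FTerm.realize]; rfl⟩
  | func f ts ih =>
    choose s hs using ih
    cases f with
    | add => exact ⟨.add (s 0) (s 1), fun K V _ _ _ β x y => by
        rw [FTerm.realize, hs, hs]; rfl⟩
    | mul => exact ⟨.mul (s 0) (s 1), fun K V _ _ _ β x y => by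
        rw [FTerm.realize, hs, hs]; rfl⟩
    | neg => exact ⟨.neg (s 0), fun K V _ _ _ β x y => by
        rw [FTerm.realize, hs]; rfl⟩
    | zero => exact ⟨.zero, fun K V _ _ _ β x y => by rw [FTerm.realize]; rfl⟩
    | one => exact ⟨.one, fun K V _ _ _ β x y => by rw [FTerm.realize]; rfl⟩

theorem exists_formula_of_ringFormula {m n l : ℕ}
    (ψ : Language.ring.BoundedFormula (DataIndex m (rowCount n) n) l) :
    ∃ θ : Formula (m + l) n, θ.OnlyFieldQuantifiers ∧
      ∀ (K V : Type u) [Field K] [AddCommGroup V] [Module K V]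
        (β : LinearMap.BilinForm K V) (x : Fin (m + l) → K) (y : Fin n → V),
        letI := Ring.compatibleRingOfRing K
        θ.Realize β x y ↔ ψ.Realize (canonicalData β (fun j => x (Fin.castAdd l j)) y)
          fun j => x (Fin.natAdd m j) := by
  induction ψ with
  | falsum => exact ⟨.falsum, trivial, fun _ _ _ _ _ _ _ _ => Iff.rfl⟩
  | equal t₁ t₂ =>
    obtain ⟨s₁, h₁⟩ := exists_term_of_ringTerm.{u} t₁
    obtain ⟨s₂, h₂⟩ := exists_term_of_ringTerm.{u} t₂
    refine ⟨.eqF s₁ s₂, trivial, fun K V _ _ _ β x y => ?_⟩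
    rw [Formula.Realize, h₁, h₂]
    rfl
  | rel R => exact (IsEmpty.false R).elim
  | imp ψ₁ ψ₂ ih₁ ih₂ =>
    obtain ⟨θ₁, ho₁, h₁⟩ := ih₁
    obtain ⟨θ₂, ho₂, h₂⟩ := ih₂
    exact ⟨.imp θ₁ θ₂, ⟨ho₁, ho₂⟩, fun K V _ _ _ β x y =>
      imp_congr (h₁ K V β x y) (h₂ K V β x y)⟩
  | @all l ψ ih =>
    obtain ⟨θ, ho, h⟩ := ih
    refine ⟨.allF θ, ho, fun K V _ _ _ β x y => forall_congr' fun a => ?_⟩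
    rw [h]
    have h1 (j : Fin m) : (Fin.snoc x a : Fin (m + l + 1) → K) (Fin.castAdd (l + 1) j) =
        x (Fin.castAdd l j) := Fin.snoc_castSucc (α := fun _ => K) a x (Fin.castAdd l j)
    have h2 : (fun j => (Fin.snoc x a : Fin (m + l + 1) → K) (Fin.natAdd m j)) =
        (Fin.snoc (fun j => x (Fin.natAdd m j)) a : Fin (l + 1) → K) := by
      funext j
      refine Fin.lastCases ?_ (fun j => ?_) j
      · rw [Fin.snoc_last]
        exact Fin.snoc_last (α := fun _ => K) a x
      · rw [Fin.snoc_castSucc]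
        exact Fin.snoc_castSucc (α := fun _ => K) a x (Fin.natAdd m j)
    simp only [h1]
    exact Eq.to_iff (congrArg _ h2)

/-- Elimination of quantifiers down to the field, for either kind of forms. -/
theorem eliminatesQuantifiersDownToField (κ : FormKind) {T₀ : Language.ring.Theory}
    (hT₀ : IsCompletionOf T₀ PSFNeTwo) : EliminatesQuantifiersDownToField.{u} κ T₀ := by
  intro m n φ
  obtain ⟨P, ⟨ψ, hψ⟩, hP⟩ := Formula.exists_definedBy.{u} (κ := κ) hT₀ φ (rowCount n)
  have hφ (K V : Type u) [Field K] [AddCommGroup V] [Module K V] (β : LinearMap.BilinForm K V)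
      (h : IsModel κ T₀ K V β) (x : Fin m → K) (y : Fin n → V) :
      φ.Realize β x y ↔ FieldRealize K ψ (canonicalData β x y) :=
    ((hψ K _).trans (hP K V β h x y _ (presents_relationMatrix y _))).symm
  constructor
  · obtain ⟨θ, ho, hθ⟩ := exists_formula_of_ringFormula.{u} ψ
    refine ⟨θ, ho, fun K V _ _ _ β h x y => ?_⟩
    rw [hφ K V β h]
    refine Iff.symm ((hθ K V β x y).trans ?_)
    exact Eq.to_iff (congrArg _ (Subsingleton.elim _ _))
  · let e := Fintype.equivFin (DataIndex m (rowCount n) n)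
    refine ⟨_, Language.Formula.relabel e ψ, fun i => dataTerm id (e.symm i),
      fun K V _ _ _ β h x y => ?_⟩
    rw [hφ K V β h]
    let := Ring.compatibleRingOfRing K
    refine Iff.symm (Language.Formula.realize_relabel.trans ?_)
    refine Eq.to_iff (congrArg _ (funext fun i => ?_))
    simp [realize_dataTerm]

end Granger

theorem mainTheorem11 (T₀ : FirstOrder.Language.ring.Theory)
    (hT₀ : Granger.IsCompletionOf T₀ Granger.PSFNeTwo) :
    Granger.EliminatesQuantifiersDownToField.{u} Granger.FormKind.symmetric T₀ ∧
      Granger.EliminatesQuantifiersDownToField.{u} Granger.FormKind.alternating T₀ :=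
  ⟨Granger.eliminatesQuantifiersDownToField _ hT₀, Granger.eliminatesQuantifiersDownToField _ hT₀⟩
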